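/- For $p\in(0,1)$ and $k>0$ let $Z_p$, $t_{(p,k)}$ and $\chi^2_{p,k}$ denote the $p$-quantiles of, respectively, the standard normal distribution, Student's $t$-distribution with $k$ degrees of freedom, and the chi-square distribution with $k$ degrees of freedom. For a sample $x=(x_1,\dots,x_n)\in\mathbb{R}^n$ with mean $\bar x=\frac1n\sum_i x_i$ and standard deviation $\hat\sigma=\sqrt{\frac{1}{n-1}\sum_i (x_i-\bar x)^2}$, let $$I^{Tol}_{\gamma,\beta}=\left[\bar x-\mathbf{c}\,\hat\sigma,\ \bar x+\mathbf{c}\,\hat\sigma\right],\qquad \mathbf{c}=\sqrt{\frac{(n-1)\left(1+\frac1n\right)Z^2_{1-\frac{1-\beta}{2}}}{\chi^2_{1-\gamma,n-1}}},$$ be the two-sided $\gamma$-coverage $\beta$-content normal tolerance interval (with Howe's factor), let $$I^{Pred}_{\beta}=\left[\bar x-\left|t_{(\frac{1-\beta}{2},n-1)}\right|\hat\sigma\sqrt{1+\tfrac1n},\ \bar x+\left|t_{(\frac{1-\beta}{2},n-1)}\right|\hat\sigma\sqrt{1+\tfrac1n}\right]$$ be the two-sided $\beta$-content normal prediction interval,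 and put $\mathrm{size}([L,U])=U-L$. Then for every integer $n$ with $20\le n\le 10000$, every real $\gamma$ with $0.7\le\gamma<1$ and every $\beta\in[0.01,0.99]$: (i) $\mathrm{size}(I^{Tol}_{\gamma,\beta})\ \ge\ \mathrm{size}(I^{Pred}_{\beta})$ for every sample $x\in\mathbb{R}^n$ (in particular for every realization of a standard normal random sample); (ii) equivalently, the ratio of the tolerance factor to the prediction factor satisfies $$\frac{Z_{\frac{1-\beta}{2}}\sqrt{n-1}}{t_{(\frac{1-\beta}{2},n-1)}\sqrt{\chi^2_{1-\gamma,n-1}}}\ \ge\ 1 .$$ -/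

import Mathlib

open MeasureTheory ProbabilityTheory

noncomputable section

namespace NormalIntervals

/-- The `p`-quantile of a probability law `μ` on the real line:
the least `x` with `μ (-∞, x] ≥ p`. -/
def quantile (μ : Measure ℝ) (p : ℝ) : ℝ :=
  sInf {x : ℝ | p ≤ μ.real (Set.Iic x)}

/-- The chi-square law with `k` degrees of freedom, i.e. the law on `(0, ∞)` with density
`x ^ (k/2 - 1) * exp (-x/2) / (2 ^ (k/2) * Γ(k/2))`
(the gamma law of shape `k/2` and rate `1/2`). -/
def chiSquare (k : ℝ) : Measure ℝ :=
  gammaMeasure (k / 2) (1 / 2)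

/-- The density of Student's t-distribution with `k` degrees of freedom. -/
def studentPDF (k x : ℝ) : ℝ :=
  Real.Gamma ((k + 1) / 2) / (Real.sqrt (k * Real.pi) * Real.Gamma (k / 2)) *
    (1 + x ^ 2 / k) ^ (-((k + 1) / 2))

/-- Student's t-distribution with `k` degrees of freedom. -/
def studentT (k : ℝ) : Measure ℝ :=
  volume.withDensity (fun x => ENNReal.ofReal (studentPDF k x))

/-- `Z_p`, the `p`-quantile of the standard normal distribution. -/
def zQuantile (p : ℝ) : ℝ := quantile (gaussianReal 0 1) p

/-- `t_{(p, k)}`, the `p`-quantile of Student's t-distribution with `k` degrees of freedom. -/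
def tQuantile (p k : ℝ) : ℝ := quantile (studentT k) p

/-- `χ²_{p, k}`, the `p`-quantile of the chi-square distribution with `k` degrees of freedom. -/
def chiSqQuantile (p k : ℝ) : ℝ := quantile (chiSquare k) p

/-- The sample mean. -/
def sampleMean {n : ℕ} (x : Fin n → ℝ) : ℝ := (∑ i, x i) / n

/-- The sample standard deviation (with the normalization `n - 1`). -/
def sampleStd {n : ℕ} (x : Fin n → ℝ) : ℝ :=
  Real.sqrt ((∑ i, (x i - sampleMean x) ^ 2) / ((n : ℝ) - 1))

/-- Howe's two-sided tolerance factor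
`c = √((n - 1) (1 + 1/n) Z²_{1 - (1-β)/2} / χ²_{1-γ, n-1})`. -/
def toleranceFactor (n : ℕ) (γ β : ℝ) : ℝ :=
  Real.sqrt (((n : ℝ) - 1) * (1 + 1 / (n : ℝ)) * zQuantile (1 - (1 - β) / 2) ^ 2 /
    chiSqQuantile (1 - γ) ((n : ℝ) - 1))

/-- The two-sided prediction factor `|t_{((1-β)/2, n-1)}| √(1 + 1/n)`. The quantile is nonpositive
for `0 < β < 1`, so the two endpoints `mean ± t * std * √(1 + 1/n)` are, in increasing order,
the mean minus and plus this nonnegative factor times the standard deviation. -/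
def predictionFactor (n : ℕ) (β : ℝ) : ℝ :=
  |tQuantile ((1 - β) / 2) ((n : ℝ) - 1)| * Real.sqrt (1 + 1 / (n : ℝ))

/-- The endpoints `(L, U)` of the two-sided `γ`-coverage `β`-content normal tolerance interval
computed from the sample `x`. -/
def toleranceInterval {n : ℕ} (γ β : ℝ) (x : Fin n → ℝ) : ℝ × ℝ :=
  (sampleMean x - toleranceFactor n γ β * sampleStd x,
   sampleMean x + toleranceFactor n γ β * sampleStd x)

/-- The endpoints `(L, U)` of the two-sided `β`-content normal prediction interval
computed from the sample `x`. -/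
def predictionInterval {n : ℕ} (β : ℝ) (x : Fin n → ℝ) : ℝ × ℝ :=
  (sampleMean x - predictionFactor n β * sampleStd x,
   sampleMean x + predictionFactor n β * sampleStd x)

/-- The size `U - L` of an interval with endpoints `(L, U)`. -/
def size (I : ℝ × ℝ) : ℝ := I.2 - I.1

end NormalIntervals

end

noncomputable section

namespace NormalIntervals

/-! Put `k = n - 1` and `p = (1 - β)/2`, so `1/200 ≤ p < 1/2`, and let `z`, `t` be the absolute
values of the normal and Student `p`-quantiles and `c` the chi-square quantile. Both claims reduce
to `t ≤ z √(k/c)`.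

Wallace's inequality (`integral_normalPDF_le_integral_studentPDF`) compares the two laws: Student's
law has at least as much mass on `[0, s]` as the normal law on `[0, w(s)]`, where `w(s)² = (k - 1/2)
log(1 + s²/k)`. Hence `t ≤ s` as soon as `z ≤ w(s)`. For `s = z √(k/c)` this condition reads
`exp(z²/(k - 1/2)) ≤ 1 + z²/c`.

The left side is convex in `z²`, the right side is affine, and they agree at `0`, so only the
largest `z²` matters; likewise only the largest `c`. A Mills ratio estimate gives `z² ≤ 133/20`
(`zQuantile_sq_le`). Since `1 - γ ≤ 3/10`, estimates of the incomplete Gamma function give `c ≤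
chiSqBound k` (`chiSqQuantile_mem`). The inequality at these extreme values is
`exp_le_one_add_div_chiSqBound`. -/

/-! ### The lower incomplete Gamma function. -/

/-- The lower incomplete Gamma function. -/
def lowerGamma (a x : ℝ) : ℝ := ∫ t in (0 : ℝ)..x, t ^ (a - 1) * Real.exp (-t)

lemma continuous_rpow_mul_exp_neg {b : ℝ} (hb : 0 ≤ b) :
    Continuous (fun t : ℝ => t ^ b * Real.exp (-t)) :=
  (Real.continuous_rpow_const hb).mul (by fun_prop)

lemma lowerGamma_nonneg {a x : ℝ} (hx : 0 ≤ x) : 0 ≤ lowerGamma a x :=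
  intervalIntegral.integral_nonneg hx fun _ ht =>
    mul_nonneg (Real.rpow_nonneg ht.1 _) (Real.exp_pos _).le

lemma lowerGamma_add_one {a x : ℝ} (ha : 1 ≤ a) :
    lowerGamma (a + 1) x = a * lowerGamma a x - x ^ a * Real.exp (-x) := by
  have hd : ∀ t ∈ Set.uIcc 0 x, HasDerivAt (fun t : ℝ => t ^ a * Real.exp (-t))
      (a * (t ^ (a - 1) * Real.exp (-t)) - t ^ (a + 1 - 1) * Real.exp (-t)) t := by
    intro t _
    have h1 := Real.hasDerivAt_rpow_const (x := t) (p := a) (Or.inr ha)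
    have h2 := (hasDerivAt_neg t).exp
    refine (h1.mul h2).congr_deriv ?_
    rw [add_sub_cancel_right]
    ring
  have c1 := continuous_rpow_mul_exp_neg (b := a - 1) (by linarith)
  have c2 := continuous_rpow_mul_exp_neg (b := a + 1 - 1) (by linarith)
  have h := intervalIntegral.integral_eq_sub_of_hasDerivAt hd
    (((c1.const_mul a).sub c2).intervalIntegrable _ _)
  rw [intervalIntegral.integral_sub ((c1.const_mul a).intervalIntegrable _ _)
    (c2.intervalIntegrable _ _), intervalIntegral.integral_const_mul,
    Real.zero_rpow (by linarith)] at h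
  simp only [lowerGamma]
  linarith

/-- Horner form of the partial sums `∑ j < N, x ^ j / (a (a + 1) ⋯ (a + j))`. -/
def gammaSeries (x : ℝ) : ℕ → ℝ → ℝ
  | 0, _ => 0
  | N + 1, a => (1 + x * gammaSeries x N (a + 1)) / a

/-- Iterating the integration by parts `N` times produces the partial sum plus a positive multiple
of `lowerGamma (a + N) x`, which is discarded. -/
lemma gammaSeries_le_lowerGamma {x : ℝ} (hx : 0 < x) (N : ℕ) :
    ∀ {a : ℝ}, 1 ≤ a → x ^ a * Real.exp (-x) * gammaSeries x N a ≤ lowerGamma a x := by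
  induction N with
  | zero => intro a _; simpa [gammaSeries] using lowerGamma_nonneg hx.le
  | succ N ih =>
    intro a ha
    have h := ih (a := a + 1) (by linarith)
    rw [lowerGamma_add_one ha, Real.rpow_add hx, Real.rpow_one] at h
    rw [gammaSeries, mul_div_assoc', div_le_iff₀ (by linarith)]
    linarith

lemma monotoneOn_rpow_mul_exp_neg {a : ℝ} (ha : 1 ≤ a) :
    MonotoneOn (fun t : ℝ => t ^ a * Real.exp (-t)) (Set.Icc 0 a) := by
  refine monotoneOn_of_deriv_nonneg (convex_Icc _ _)
    (continuous_rpow_mul_exp_neg (by linarith)).continuousOn ?_ ?_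
  · intro t _
    exact ((Real.hasDerivAt_rpow_const (x := t) (p := a) (Or.inr ha)).mul
      (hasDerivAt_neg t).exp).differentiableAt.differentiableWithinAt
  · intro t ht
    rw [interior_Icc] at ht
    have h : HasDerivAt (fun t : ℝ => t ^ a * Real.exp (-t)) _ t :=
      (Real.hasDerivAt_rpow_const (x := t) (p := a) (Or.inr ha)).mul (hasDerivAt_neg t).exp
    rw [h.deriv, Real.rpow_sub_one ht.1.ne']
    have e : a * (t ^ a / t) * Real.exp (-t) + t ^ a * (Real.exp (-t) * -1)
        = (a - t) * (t ^ a * Real.exp (-t) / t) := by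
      have := ht.1.ne'
      field_simp
      ring
    rw [e]
    exact mul_nonneg (by linarith [ht.2])
      (div_nonneg (mul_nonneg (Real.rpow_nonneg ht.1.le _) (Real.exp_pos _).le) ht.1.le)

/-- Divided by `Γ(a + 1)`, this says that the Gamma distribution function does not decrease when
shape and argument both grow by one. The boundary term `x ^ a * exp (-x)` lost by parts is regained
on `[x, x + 1]`, where the integrand increases because `x + 1 ≤ a`. -/
lemma mul_lowerGamma_le_lowerGamma_add_one {a x : ℝ} (ha : 1 ≤ a) (hx : 0 ≤ x)
    (hxa : x + 1 ≤ a) : a * lowerGamma a x ≤ lowerGamma (a + 1) (x + 1) := by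
  have c2 := continuous_rpow_mul_exp_neg (b := a) (by linarith)
  have h : lowerGamma (a + 1) (x + 1) = lowerGamma (a + 1) x +
      ∫ t in x..(x + 1), t ^ a * Real.exp (-t) := by
    simp only [lowerGamma, add_sub_cancel_right]
    rw [intervalIntegral.integral_add_adjacent_intervals] <;> exact c2.intervalIntegrable _ _
  have h2 : ∫ _ in x..(x + 1), x ^ a * Real.exp (-x) ≤
      ∫ t in x..(x + 1), t ^ a * Real.exp (-t) := by
    refine intervalIntegral.integral_mono_on (by linarith) (by simp) (c2.intervalIntegrable _ _) ?_
    intro t ht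
    exact monotoneOn_rpow_mul_exp_neg ha ⟨hx, by linarith⟩
      ⟨by linarith [ht.1], by linarith [ht.2]⟩ ht.1
  rw [intervalIntegral.integral_const] at h2
  rw [h, lowerGamma_add_one ha]
  simp at h2
  linarith

/-! ### Upper bounds for the chi-square `3/10`-quantile. -/

lemma chiSquare_real_Iic {k u : ℝ} (hk : 2 ≤ k) (hu : 0 ≤ u) :
    (chiSquare k).real (Set.Iic u) = lowerGamma (k / 2) (u / 2) / Real.Gamma (k / 2) := by
  have hk' : 0 < k / 2 := by linarith
  have : IsProbabilityMeasure (gammaMeasure (k / 2) (1 / 2)) :=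
    isProbabilityMeasure_gammaMeasure hk' (by norm_num)
  have h0 : IntegrableOn (gammaPDFReal (k / 2) (1 / 2)) (Set.Iic u) := by
    refine Integrable.integrableOn ⟨(measurable_gammaPDFReal _ _).aestronglyMeasurable, ?_⟩
    rw [hasFiniteIntegral_iff_ofReal
      (Filter.Eventually.of_forall (gammaPDFReal_nonneg hk' (by norm_num)))]
    have := lintegral_gammaPDF_eq_one hk' (show (0 : ℝ) < 1 / 2 by norm_num)
    simp only [gammaPDF] at this
    rw [this]
    exact ENNReal.one_lt_top
  have h1 := cdf_gammaMeasure_eq_integral hk' (show (0 : ℝ) < 1 / 2 by norm_num) u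
  rw [cdf_eq_real] at h1
  rw [chiSquare, h1, ← Set.Iic_union_Ioc_eq_Iic hu,
    setIntegral_union (Set.Iic_disjoint_Ioc le_rfl) measurableSet_Ioc
      (h0.mono_set (Set.Iic_subset_Iic.2 hu)) (h0.mono_set Set.Ioc_subset_Iic_self),
    -- The density is zero only on the open half-line in general, so the null point `0` is removed
    -- first.
    setIntegral_congr_set (Iio_ae_eq_Iic (a := (0 : ℝ)) (μ := volume)).symm,
    setIntegral_eq_zero_of_forall_eq_zero, zero_add,
    ← intervalIntegral.integral_of_le hu]
  · have e : ∀ t ∈ Set.uIcc 0 u, gammaPDFReal (k / 2) (1 / 2) t =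
        (1 / Real.Gamma (k / 2) * (1 / 2)) *
          ((fun s : ℝ => s ^ (k / 2 - 1) * Real.exp (-s)) (t / 2)) := by
      intro t ht
      rw [Set.uIcc_of_le hu] at ht
      have h2 : (t / 2) ^ (k / 2 - 1) = t ^ (k / 2 - 1) * ((1 / 2) ^ (k / 2) * 2) := by
        rw [div_eq_mul_one_div, Real.mul_rpow ht.1 (by norm_num), Real.rpow_sub_one (show (1 / 2 : ℝ) ≠ 0 by norm_num)]
        ring
      have h3 : -(t / 2) = -(1 / 2 * t) := by ring
      simp only [gammaPDFReal, if_pos ht.1, h2, h3]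
      ring
    rw [intervalIntegral.integral_congr e, intervalIntegral.integral_const_mul,
      intervalIntegral.integral_comp_div (fun s : ℝ => s ^ (k / 2 - 1) * Real.exp (-s))
        (two_ne_zero), lowerGamma, zero_div, smul_eq_mul]
    ring
  · intro t ht
    simp [gammaPDFReal, not_le.2 (show t < 0 from ht)]

/-- An upper bound for the `3/10`-quantile of the chi-square law with `k ≥ 19` degrees
of freedom. -/
def chiSqBound (k : ℕ) : ℝ :=
  if k = 19 then 384 / 25 else if k = 20 then 163 / 10 else if k = 21 then 69 / 4
  else k - 153 / 40

lemma exp_le_pow {x q : ℝ} (m : ℕ) (hm : 0 < m) (h : Real.exp (x / m) ≤ q) :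
    Real.exp x ≤ q ^ m := by
  have : Real.exp x = Real.exp (x / m) ^ m := by
    rw [← Real.exp_nat_mul]
    congr 1
    field_simp
  rw [this]
  exact pow_le_pow_left₀ (Real.exp_pos _).le h _

lemma exp_le_taylor {x : ℝ} (h0 : 0 ≤ x) (h1 : x ≤ 1) :
    Real.exp x ≤ 1 + x + x ^ 2 / 2 + x ^ 3 / 6 + x ^ 4 / 24 + x ^ 5 / 120 + x ^ 6 / 720
      + x ^ 7 / 5040 + x ^ 8 * (9 / (40320 * 8)) := by
  have h := Real.exp_bound' h0 h1 (show 0 < 8 by norm_num)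
  simp only [Finset.sum_range_succ, Finset.sum_range_zero, Nat.factorial] at h
  norm_num at h
  linarith

/-- Lower bound for an incomplete Gamma function at an integer. -/
lemma le_lowerGamma_of_nat {x q : ℝ} (m N : ℕ) (hx : 0 < x)
    (hq : Real.exp x ≤ q)
    (h : 3 / 10 * q * (m.factorial : ℝ) ≤ x ^ (m + 1) * gammaSeries x N (m + 1)) :
    3 / 10 * Real.Gamma (m + 1) ≤ lowerGamma (m + 1) x := by
  have hg := gammaSeries_le_lowerGamma hx N (a := m + 1) (by linarith [m.cast_nonneg (α := ℝ)])
  have hq' : q * Real.exp (-x) ≥ 1 := by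
    rw [Real.exp_neg, ← div_eq_mul_inv, ge_iff_le, one_le_div (Real.exp_pos _)]
    exact hq
  rw [show ((m : ℝ) + 1) = ((m + 1 : ℕ) : ℝ) by push_cast; rfl, Real.rpow_natCast] at hg
  rw [Real.Gamma_nat_eq_factorial]
  push_cast at hg
  calc 3 / 10 * (m.factorial : ℝ) ≤ 3 / 10 * (m.factorial : ℝ) * (q * Real.exp (-x)) :=
        le_mul_of_one_le_right (by positivity) hq'
    _ = (3 / 10 * q * (m.factorial : ℝ)) * Real.exp (-x) := by ring
    _ ≤ x ^ (m + 1) * gammaSeries x N (m + 1) * Real.exp (-x) :=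
        mul_le_mul_of_nonneg_right h (Real.exp_pos _).le
    _ ≤ _ := le_trans (le_of_eq (by ring)) hg

/-- Lower bound for an incomplete Gamma function at a half-integer. -/
lemma le_lowerGamma_of_half {x q r : ℝ} (m N : ℕ) (hx : 0 < x) (hm : 1 ≤ m)
    (hq : Real.exp x ≤ q) (hr : r ^ 2 * 3.1416 ≤ x)
    (h : 3 / 10 * q * (((2 * m - 1).doubleFactorial : ℝ) / 2 ^ m) ≤
      x ^ m * r * gammaSeries x N (m + 1 / 2)) (hS : 0 ≤ gammaSeries x N (m + 1 / 2)) :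
    3 / 10 * Real.Gamma (m + 1 / 2) ≤ lowerGamma (m + 1 / 2) x := by
  have hm' : (1 : ℝ) ≤ m := by exact_mod_cast hm
  have hg := gammaSeries_le_lowerGamma hx N (a := m + 1 / 2) (by linarith)
  have hq' : q * Real.exp (-x) ≥ 1 := by
    rw [Real.exp_neg, ← div_eq_mul_inv, ge_iff_le, one_le_div (Real.exp_pos _)]
    exact hq
  -- The rational `r` stands for `√(x/π)`: the `√π` inside `Γ(m + 1/2)` then cancels, leaving a
  -- rational inequality.
  have hs : r * √Real.pi ≤ √x := by
    refine Real.le_sqrt_of_sq_le ?_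
    rw [mul_pow, Real.sq_sqrt Real.pi_pos.le]
    have := Real.pi_lt_d4
    nlinarith [sq_nonneg r]
  rw [Real.rpow_add hx, Real.rpow_natCast, ← Real.sqrt_eq_rpow] at hg
  rw [Real.Gamma_nat_add_half]
  calc 3 / 10 * (((2 * m - 1).doubleFactorial : ℝ) * √Real.pi / 2 ^ m)
      ≤ 3 / 10 * (((2 * m - 1).doubleFactorial : ℝ) * √Real.pi / 2 ^ m) *
        (q * Real.exp (-x)) := le_mul_of_one_le_right (by positivity) hq'
    _ = (3 / 10 * q * (((2 * m - 1).doubleFactorial : ℝ) / 2 ^ m)) *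
        (√Real.pi * Real.exp (-x)) := by ring
    _ ≤ (x ^ m * r * gammaSeries x N (m + 1 / 2)) * (√Real.pi * Real.exp (-x)) :=
        mul_le_mul_of_nonneg_right h (by positivity)
    _ = (r * √Real.pi) * (x ^ m * gammaSeries x N (m + 1 / 2) * Real.exp (-x)) := by ring
    _ ≤ √x * (x ^ m * gammaSeries x N (m + 1 / 2) * Real.exp (-x)) :=
        mul_le_mul_of_nonneg_right hs (by positivity)
    _ ≤ _ := le_trans (le_of_eq (by ring)) hg

lemma lowerGamma_ge_nineteen : 3 / 10 * Real.Gamma (19 / 2) ≤ lowerGamma (19 / 2) (192 / 25) := by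
  have he : Real.exp (192 / 25 : ℝ) ≤ 2164.63 :=
    (exp_le_pow 10 (by norm_num) (exp_le_taylor (by norm_num) (by norm_num))).trans (by norm_num)
  have := le_lowerGamma_of_half (x := 192 / 25) (r := 1.5635) 9 15 (by norm_num) (by norm_num)
    he (by norm_num)
    (by norm_num [gammaSeries, Nat.doubleFactorial]) (by norm_num [gammaSeries])
  norm_num at this ⊢
  exact this

lemma lowerGamma_ge_twenty : 3 / 10 * Real.Gamma 10 ≤ lowerGamma 10 (163 / 20) := by
  have he : Real.exp (163 / 20 : ℝ) ≤ 3465 :=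
    (exp_le_pow 10 (by norm_num) (exp_le_taylor (by norm_num) (by norm_num))).trans (by norm_num)
  have := le_lowerGamma_of_nat (x := 163 / 20) 9 15 (by norm_num) he
    (by norm_num [gammaSeries, Nat.factorial])
  norm_num at this ⊢
  exact this

lemma lowerGamma_ge_twentyone :
    3 / 10 * Real.Gamma (21 / 2) ≤ lowerGamma (21 / 2) (69 / 8) := by
  have he : Real.exp (69 / 8 : ℝ) ≤ 5570 :=
    (exp_le_pow 10 (by norm_num) (exp_le_taylor (by norm_num) (by norm_num))).trans (by norm_num)
  have := le_lowerGamma_of_half (x := 69 / 8) (r := 1.656) 10 15 (by norm_num) (by norm_num)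
    he (by norm_num)
    (by norm_num [gammaSeries, Nat.doubleFactorial]) (by norm_num [gammaSeries])
  norm_num at this ⊢
  exact this

lemma lowerGamma_ge_twentytwo : 3 / 10 * Real.Gamma 11 ≤ lowerGamma 11 (727 / 80) := by
  have he : Real.exp (727 / 80 : ℝ) ≤ 8850 :=
    (exp_le_pow 10 (by norm_num) (exp_le_taylor (by norm_num) (by norm_num))).trans (by norm_num)
  have := le_lowerGamma_of_nat (x := 727 / 80) 10 15 (by norm_num) he
    (by norm_num [gammaSeries, Nat.factorial])
  norm_num at this ⊢
  exact this

lemma lowerGamma_ge_twentythree :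
    3 / 10 * Real.Gamma (23 / 2) ≤ lowerGamma (23 / 2) (767 / 80) := by
  have he : Real.exp (767 / 80 : ℝ) ≤ 14600 :=
    (exp_le_pow 10 (by norm_num) (exp_le_taylor (by norm_num) (by norm_num))).trans (by norm_num)
  have := le_lowerGamma_of_half (x := 767 / 80) (r := 1.746) 11 15 (by norm_num) (by norm_num)
    he (by norm_num)
    (by norm_num [gammaSeries, Nat.doubleFactorial]) (by norm_num [gammaSeries])
  norm_num at this ⊢
  exact this

/-- Going from `k` to `k + 2` moves shape and argument by exactly one, so a bound of the form `k`
minus a constant propagates from the two base cases `22` and `23`. -/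
lemma lowerGamma_ge_of_ge_twentytwo (k : ℕ) (hk : 22 ≤ k) :
    3 / 10 * Real.Gamma (k / 2) ≤ lowerGamma (k / 2) ((k - 153 / 40) / 2) := by
  induction k using Nat.strong_induction_on with
  | _ k ih =>
  rcases Nat.lt_or_ge k 24 with h | h
  · interval_cases k
    · convert lowerGamma_ge_twentytwo using 2 <;> norm_num
    · convert lowerGamma_ge_twentythree using 2 <;> norm_num
  · obtain ⟨j, rfl⟩ : ∃ j, k = j + 2 := ⟨k - 2, by omega⟩
    have hj : (22 : ℝ) ≤ j := by exact_mod_cast (by omega : 22 ≤ j)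
    have h1 := ih j (by omega) (by omega)
    have h2 := mul_lowerGamma_le_lowerGamma_add_one (a := (j : ℝ) / 2)
      (x := ((j : ℝ) - 153 / 40) / 2) (by linarith) (by linarith) (by linarith)
    have e1 : ((j + 2 : ℕ) : ℝ) / 2 = (j : ℝ) / 2 + 1 := by push_cast; ring
    have e2 : (((j + 2 : ℕ) : ℝ) - 153 / 40) / 2 = ((j : ℝ) - 153 / 40) / 2 + 1 := by
      push_cast; ring
    rw [e1, e2, Real.Gamma_add_one (by linarith)]
    refine le_trans ?_ h2
    have := mul_le_mul_of_nonneg_left h1 (show 0 ≤ (j : ℝ) / 2 by linarith)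
    linarith

lemma fifteen_lt_chiSqBound {k : ℕ} (hk : 19 ≤ k) : 15 < chiSqBound k := by
  unfold chiSqBound
  split_ifs <;> try norm_num
  have : (22 : ℝ) ≤ k := by exact_mod_cast (by omega : 22 ≤ k)
  linarith

lemma chiSquare_real_Iic_chiSqBound {k : ℕ} (hk : 19 ≤ k) :
    3 / 10 ≤ (chiSquare k).real (Set.Iic (chiSqBound k)) := by
  have hk' : (19 : ℝ) ≤ k := by exact_mod_cast hk
  rw [chiSquare_real_Iic (by linarith) (by linarith [fifteen_lt_chiSqBound hk]),
    le_div_iff₀ (Real.Gamma_pos_of_pos (by linarith))]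
  unfold chiSqBound
  split_ifs with h1 h2 h3
  · subst h1
    have := lowerGamma_ge_nineteen
    norm_num at this ⊢
    exact this
  · subst h2
    have := lowerGamma_ge_twenty
    norm_num at this ⊢
    exact this
  · subst h3
    have := lowerGamma_ge_twentyone
    norm_num at this ⊢
    exact this
  · exact lowerGamma_ge_of_ge_twentytwo k (by omega)

/-! ### The exponential inequality at the extreme values. -/

/-- This limits `chiSqBound` from above, while the true quantile limits it from below. At `k = 19`
the room is only about `15.352` to `15.374`, whence `384/25`. The linear formula falls below the
quantile for `k = 19, 20, 21`, so these have their own values. -/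
lemma exp_le_one_add_div_chiSqBound {k : ℕ} (hk : 19 ≤ k) :
    Real.exp (133 / 20 / (k - 1 / 2)) ≤ 1 + 133 / 20 / chiSqBound k := by
  unfold chiSqBound
  split_ifs with h1 h2 h3
  · subst h1
    exact (exp_le_taylor (by norm_num) (by norm_num)).trans (by norm_num)
  · subst h2
    exact (exp_le_taylor (by norm_num) (by norm_num)).trans (by norm_num)
  · subst h3
    exact (exp_le_taylor (by norm_num) (by norm_num)).trans (by norm_num)
  · have hk' : (22 : ℝ) ≤ k := by exact_mod_cast (by omega : 22 ≤ k)
    have hu : (0 : ℝ) < k - 153 / 40 := by linarith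
    -- With `u = k - 153/40` and `w = 133/20`, the bound `log (1 + x) ≥ 2x/(x + 2)` at `x = w/u`
    -- gives `w/(u + w/2)`. The offset `153/40 = 1/2 + 133/40` makes `u + w/2` exactly `k - 1/2`.
    have h := Real.le_log_one_add_of_nonneg (x := 133 / 20 / ((k : ℝ) - 153 / 40)) (by positivity)
    rw [← Real.le_log_iff_exp_le (by positivity)]
    refine le_trans (le_of_eq ?_) h
    have hu' : (0 : ℝ) < k - 1 / 2 := by linarith
    have hd : (0 : ℝ) < 133 / 20 + 2 * (k - 153 / 40) := by linarith
    have e : 133 / 20 / ((k : ℝ) - 153 / 40) + 2 =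
        (133 / 20 + 2 * (k - 153 / 40)) / (k - 153 / 40) := by
      rw [add_div, mul_div_cancel_right₀ _ hu.ne']
    rw [e, mul_div_assoc', div_div_div_cancel_right₀ hu.ne', div_eq_div_iff hu'.ne' hd.ne']
    ring

/-- The inequality at the endpoint `w = 133/20` extends to smaller `w` by convexity of `exp`. -/
lemma le_mul_log_one_add_div {k : ℕ} (hk : 19 ≤ k) {w c : ℝ} (hw : 0 ≤ w) (hw' : w ≤ 133 / 20)
    (hc : 0 < c) (hc' : c ≤ chiSqBound k) :
    w ≤ (k - 1 / 2) * Real.log (1 + w / c) := by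
  have hk' : (19 : ℝ) ≤ k := by exact_mod_cast hk
  have hu : (0 : ℝ) < k - 1 / 2 := by linarith
  rw [← div_le_iff₀' hu, Real.le_log_iff_exp_le (by positivity)]
  have h := exp_le_one_add_div_chiSqBound hk
  have hcv := convexOn_exp.2 (Set.mem_univ 0) (Set.mem_univ (133 / 20 / ((k : ℝ) - 1 / 2)))
    (show 0 ≤ 1 - w / (133 / 20)
    by rw [sub_nonneg, div_le_one (by norm_num)]; exact hw')
    (show 0 ≤ w / (133 / 20) by positivity) (by ring)
  simp only [smul_eq_mul, Real.exp_zero, mul_zero, zero_add, mul_one] at hcv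
  have e : w / (133 / 20) * (133 / 20 / ((k : ℝ) - 1 / 2)) = w / (k - 1 / 2) := by
    field_simp
  rw [e] at hcv
  have h2 : w / (133 / 20) * Real.exp (133 / 20 / ((k : ℝ) - 1 / 2)) ≤
      w / (133 / 20) * (1 + 133 / 20 / chiSqBound k) :=
    mul_le_mul_of_nonneg_left h (by positivity)
  have hb : 0 < chiSqBound k := hc.trans_le hc'
  have h3 : w / (133 / 20) * (1 + 133 / 20 / chiSqBound k) =
      w / (133 / 20) + w / chiSqBound k := by
    field_simp
  have h4 : w / chiSqBound k ≤ w / c := div_le_div_of_nonneg_left hw hc hc'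
  linarith

/-! ### Distribution functions of even densities. -/

section EvenDensity

variable {f : ℝ → ℝ}

lemma integral_Ioi_zero_of_even (hi : Integrable f) (he : ∀ x, f (-x) = f x)
    (h1 : ∫ x, f x = 1) : ∫ x in Set.Ioi 0, f x = 1 / 2 := by
  have h2 := intervalIntegral.integral_Iic_add_Ioi (b := (0 : ℝ)) hi.integrableOn hi.integrableOn
  have h3 := integral_comp_neg_Iic (0 : ℝ) f
  simp only [he, neg_zero] at h3
  linarith

lemma integral_Iic_of_even (hi : Integrable f) (he : ∀ x, f (-x) = f x)
    (h1 : ∫ x, f x = 1) (x : ℝ) :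
    ∫ t in Set.Iic x, f t = 1 / 2 + ∫ t in (0 : ℝ)..x, f t := by
  have h2 := intervalIntegral.integral_Iic_add_Ioi (b := (0 : ℝ)) hi.integrableOn hi.integrableOn
  have h3 := integral_Ioi_zero_of_even hi he h1
  have h4 := intervalIntegral.integral_Iic_sub_Iic (a := (0 : ℝ)) (b := x)
    hi.integrableOn hi.integrableOn
  linarith

lemma integral_Iic_neg_of_even (hi : Integrable f) (he : ∀ x, f (-x) = f x)
    (h1 : ∫ x, f x = 1) (x : ℝ) :
    ∫ t in Set.Iic (-x), f t = 1 / 2 - ∫ t in (0 : ℝ)..x, f t := by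
  have h := intervalIntegral.integral_comp_neg (a := 0) (b := x) f
  simp only [he, neg_zero] at h
  rw [integral_Iic_of_even hi he h1, h, intervalIntegral.integral_symm]
  ring

lemma tendsto_integral_of_even (hi : Integrable f) (he : ∀ x, f (-x) = f x)
    (h1 : ∫ x, f x = 1) :
    Filter.Tendsto (fun x => ∫ t in (0 : ℝ)..x, f t) Filter.atTop (nhds (1 / 2)) := by
  rw [← integral_Ioi_zero_of_even hi he h1]
  exact intervalIntegral_tendsto_integral_Ioi 0 hi.integrableOn Filter.tendsto_id

end EvenDensity

/-! ### Student's density: normalization and distribution function. -/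

section Student

lemma lintegral_rpow_mul_exp {a r : ℝ} (ha : 0 < a) (hr : 0 < r) :
    ∫⁻ t in Set.Ioi (0 : ℝ), ENNReal.ofReal (t ^ (a - 1) * Real.exp (-(r * t))) =
      ENNReal.ofReal ((1 / r) ^ a * Real.Gamma a) := by
  have h := Real.integral_rpow_mul_exp_neg_mul_Ioi ha hr
  have hpos : 0 < (1 / r) ^ a * Real.Gamma a :=
    mul_pos (Real.rpow_pos_of_pos (by positivity) _) (Real.Gamma_pos_of_pos ha)
  rw [← h, ofReal_integral_eq_lintegral_ofReal]
  -- A Bochner integral with a nonzero value can only come from an integrable function.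
  · exact Integrable.of_integral_ne_zero (by rw [h]; exact hpos.ne')
  · refine (ae_restrict_iff' measurableSet_Ioi).2 (Filter.Eventually.of_forall fun t ht => ?_)
    exact mul_nonneg (Real.rpow_nonneg (le_of_lt ht) _) (Real.exp_pos _).le

lemma lintegral_exp_neg_mul_sq {b : ℝ} (hb : 0 < b) :
    ∫⁻ x : ℝ, ENNReal.ofReal (Real.exp (-b * x ^ 2)) = ENNReal.ofReal √(Real.pi / b) := by
  rw [← integral_gaussian, ofReal_integral_eq_lintegral_ofReal (integrable_exp_neg_mul_sq hb)]
  exact Filter.Eventually.of_forall fun x => (Real.exp_pos _).le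

/-- The power is written as a Gamma integral in `y`; after Tonelli the `x`-integral is Gaussian and
the remaining `y`-integral is `Γ(k/2)`. -/
lemma lintegral_one_add_sq_div_rpow {k : ℝ} (hk : 0 < k) :
    ∫⁻ x : ℝ, ENNReal.ofReal ((1 + x ^ 2 / k) ^ (-((k + 1) / 2))) =
      ENNReal.ofReal (√(k * Real.pi) * Real.Gamma (k / 2) / Real.Gamma ((k + 1) / 2)) := by
  have ha : 0 < (k + 1) / 2 := by linarith
  have hG := Real.Gamma_pos_of_pos ha
  have h1 : ∀ x : ℝ, ENNReal.ofReal ((1 + x ^ 2 / k) ^ (-((k + 1) / 2))) =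
      ENNReal.ofReal (Real.Gamma ((k + 1) / 2))⁻¹ *
      ∫⁻ y in Set.Ioi (0 : ℝ),
        ENNReal.ofReal (y ^ ((k + 1) / 2 - 1) * Real.exp (-((1 + x ^ 2 / k) * y))) := by
    intro x
    have hx : 0 < 1 + x ^ 2 / k := by positivity
    rw [lintegral_rpow_mul_exp ha hx, ← ENNReal.ofReal_mul (by positivity)]
    congr 1
    rw [Real.rpow_neg hx.le, one_div, Real.inv_rpow hx.le]
    field_simp
  have h2 : ∀ y ∈ Set.Ioi (0 : ℝ), ∫⁻ x : ℝ,
      ENNReal.ofReal (y ^ ((k + 1) / 2 - 1) * Real.exp (-((1 + x ^ 2 / k) * y))) =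
      ENNReal.ofReal √(k * Real.pi) *
        ENNReal.ofReal (y ^ (k / 2 - 1) * Real.exp (-(1 * y))) := by
    intro y hy
    have hy : 0 < y := hy
    have e : ∀ x : ℝ, y ^ ((k + 1) / 2 - 1) * Real.exp (-((1 + x ^ 2 / k) * y)) =
        y ^ ((k + 1) / 2 - 1) * Real.exp (-y) * Real.exp (-(y / k) * x ^ 2) := by
      intro x
      rw [mul_assoc, ← Real.exp_add]
      congr 2
      ring
    have e2 : y ^ ((k + 1) / 2 - 1) = y ^ (k / 2 - 1) * √y := by
      rw [Real.sqrt_eq_rpow, ← Real.rpow_add hy]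
      congr 1
      ring
    have e3 : √y * √(Real.pi / (y / k)) = √(k * Real.pi) := by
      rw [← Real.sqrt_mul hy.le]
      congr 1
      field_simp
    simp_rw [e]
    have hc : 0 ≤ y ^ ((k + 1) / 2 - 1) * Real.exp (-y) := by positivity
    simp_rw [ENNReal.ofReal_mul hc]
    rw [lintegral_const_mul' _ _ ENNReal.ofReal_ne_top, lintegral_exp_neg_mul_sq (by positivity),
      ← ENNReal.ofReal_mul hc, ← ENNReal.ofReal_mul (by positivity), ← e3, e2, one_mul]
    congr 1
    ring
  simp_rw [h1]
  rw [lintegral_const_mul' _ _ ENNReal.ofReal_ne_top, lintegral_lintegral_swap,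
    setLIntegral_congr_fun measurableSet_Ioi h2, lintegral_const_mul' _ _ ENNReal.ofReal_ne_top,
    lintegral_rpow_mul_exp (by linarith) one_pos, ← ENNReal.ofReal_mul (by positivity),
    ← ENNReal.ofReal_mul (by positivity)]
  · congr 1
    rw [div_one, Real.one_rpow]
    ring
  · refine Measurable.aemeasurable ?_
    fun_prop

/-- The normalizing constant of Student's density. -/
def studentConst (k : ℝ) : ℝ :=
  Real.Gamma ((k + 1) / 2) / (√(k * Real.pi) * Real.Gamma (k / 2))

lemma studentConst_pos {k : ℝ} (hk : 0 < k) : 0 < studentConst k := by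
  have := Real.pi_pos
  exact div_pos (Real.Gamma_pos_of_pos (by linarith))
    (mul_pos (Real.sqrt_pos.2 (by positivity)) (Real.Gamma_pos_of_pos (by linarith)))

lemma studentPDF_pos {k : ℝ} (hk : 0 < k) (x : ℝ) : 0 < studentPDF k x :=
  mul_pos (studentConst_pos hk) (Real.rpow_pos_of_pos (by positivity) _)

lemma studentPDF_neg (k x : ℝ) : studentPDF k (-x) = studentPDF k x := by
  simp [studentPDF]

lemma continuous_studentPDF {k : ℝ} (hk : 0 < k) : Continuous (studentPDF k) := by
  unfold studentPDF
  refine continuous_const.mul (Continuous.rpow_const (by fun_prop) fun x => Or.inl ?_)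
  positivity

lemma lintegral_studentPDF {k : ℝ} (hk : 0 < k) :
    ∫⁻ x, ENNReal.ofReal (studentPDF k x) = 1 := by
  have hc := studentConst_pos hk
  have e : ∀ x, ENNReal.ofReal (studentPDF k x) = ENNReal.ofReal (studentConst k) *
      ENNReal.ofReal ((1 + x ^ 2 / k) ^ (-((k + 1) / 2))) := fun x => by
    rw [← ENNReal.ofReal_mul hc.le]; rfl
  simp_rw [e]
  rw [lintegral_const_mul' _ _ ENNReal.ofReal_ne_top, lintegral_one_add_sq_div_rpow hk,
    ← ENNReal.ofReal_mul hc.le, ← ENNReal.ofReal_one]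
  congr 1
  have h1 := Real.Gamma_pos_of_pos (show 0 < (k + 1) / 2 by linarith)
  have h2 := Real.Gamma_pos_of_pos (show 0 < k / 2 by linarith)
  have h3 : 0 < √(k * Real.pi) := Real.sqrt_pos.2 (mul_pos hk Real.pi_pos)
  unfold studentConst
  field_simp

lemma integrable_studentPDF {k : ℝ} (hk : 0 < k) : Integrable (studentPDF k) := by
  refine ⟨(continuous_studentPDF hk).aestronglyMeasurable, ?_⟩
  rw [hasFiniteIntegral_iff_ofReal
    (Filter.Eventually.of_forall fun x => (studentPDF_pos hk x).le), lintegral_studentPDF hk]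
  exact ENNReal.one_lt_top

lemma integral_studentPDF {k : ℝ} (hk : 0 < k) : ∫ x, studentPDF k x = 1 := by
  rw [integral_eq_lintegral_of_nonneg_ae
    (Filter.Eventually.of_forall fun x => (studentPDF_pos hk x).le)
    (continuous_studentPDF hk).aestronglyMeasurable, lintegral_studentPDF hk]
  simp

lemma studentT_real_Iic {k : ℝ} (hk : 0 < k) (x : ℝ) :
    (studentT k).real (Set.Iic x) = ∫ t in Set.Iic x, studentPDF k t := by
  rw [studentT, measureReal_def, withDensity_apply _ measurableSet_Iic]
  exact (integral_eq_lintegral_of_nonneg_ae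
    (Filter.Eventually.of_forall fun x => (studentPDF_pos hk x).le)
    (continuous_studentPDF hk).aestronglyMeasurable).symm

lemma studentT_real_Iic_neg {k : ℝ} (hk : 0 < k) (x : ℝ) :
    (studentT k).real (Set.Iic (-x)) = 1 / 2 - ∫ t in (0 : ℝ)..x, studentPDF k t := by
  rw [studentT_real_Iic hk]
  exact integral_Iic_neg_of_even (integrable_studentPDF hk) (studentPDF_neg k)
    (integral_studentPDF hk) x

end Student

/-! ### The standard normal density and distribution function. -/

section Normal

/-- The standard normal density. -/
def normalPDF (x : ℝ) : ℝ := (√(2 * Real.pi))⁻¹ * Real.exp (-x ^ 2 / 2)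

lemma normalPDF_eq : normalPDF = gaussianPDFReal 0 1 := by
  ext x
  simp [normalPDF, gaussianPDFReal]

lemma normalPDF_pos (x : ℝ) : 0 < normalPDF x :=
  mul_pos (inv_pos.2 (Real.sqrt_pos.2 (by have := Real.pi_pos; positivity))) (Real.exp_pos _)

lemma normalPDF_neg (x : ℝ) : normalPDF (-x) = normalPDF x := by simp [normalPDF]

lemma continuous_normalPDF : Continuous normalPDF := by unfold normalPDF; fun_prop

lemma integrable_normalPDF : Integrable normalPDF := by
  rw [normalPDF_eq]; exact integrable_gaussianPDFReal 0 1

lemma integral_normalPDF : ∫ x, normalPDF x = 1 := by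
  rw [normalPDF_eq]; exact integral_gaussianPDFReal_eq_one 0 one_ne_zero

lemma gaussianReal_real_Iic (x : ℝ) :
    (gaussianReal 0 1).real (Set.Iic x) = ∫ t in Set.Iic x, normalPDF t := by
  rw [measureReal_def, gaussianReal_apply_eq_integral 0 one_ne_zero, ← normalPDF_eq,
    ENNReal.toReal_ofReal]
  exact setIntegral_nonneg measurableSet_Iic fun t _ => (normalPDF_pos t).le

lemma gaussianReal_real_Iic_eq (x : ℝ) :
    (gaussianReal 0 1).real (Set.Iic x) = 1 / 2 + ∫ t in (0 : ℝ)..x, normalPDF t := by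
  rw [gaussianReal_real_Iic]
  exact integral_Iic_of_even integrable_normalPDF normalPDF_neg integral_normalPDF x

lemma gaussianReal_real_Iic_neg (x : ℝ) :
    (gaussianReal 0 1).real (Set.Iic (-x)) = 1 / 2 - ∫ t in (0 : ℝ)..x, normalPDF t := by
  rw [gaussianReal_real_Iic]
  exact integral_Iic_neg_of_even integrable_normalPDF normalPDF_neg integral_normalPDF x

end Normal

/-! ### Wallace's comparison of Student's law with the normal law. -/

section Wallace

/-- The map `t ↦ √((k - 1/2) log (1 + t²/k))` of Wallace's lower bound for the normal deviate
associated with a value of Student's law. -/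
def wallace (k t : ℝ) : ℝ := √((k - 1 / 2) * Real.log (1 + t ^ 2 / k))

lemma sinh_div_le_sinh_div {x y : ℝ} (hx : 0 < x) (hxy : x ≤ y) :
    Real.sinh x / x ≤ Real.sinh y / y := by
  have hm : MonotoneOn (fun s => s * Real.cosh s - Real.sinh s) (Set.Ici 0) := by
    refine monotoneOn_of_deriv_nonneg (convex_Ici _) (by fun_prop) (by fun_prop) fun s hs => ?_
    rw [interior_Ici] at hs
    have h : HasDerivAt (fun s => s * Real.cosh s - Real.sinh s) _ s :=
      ((hasDerivAt_id s).mul (Real.hasDerivAt_cosh s)).sub (Real.hasDerivAt_sinh s)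
    rw [h.deriv]
    have := mul_nonneg (le_of_lt hs) (Real.sinh_nonneg_iff.2 (le_of_lt hs))
    simp
    linarith
  have hd : ∀ s : ℝ, 0 < s → HasDerivAt (fun s => Real.sinh s / s)
      ((Real.cosh s * s - Real.sinh s * 1) / s ^ 2) s := fun s hs =>
    (Real.hasDerivAt_sinh s).div (hasDerivAt_id s) hs.ne'
  have h : MonotoneOn (fun s => Real.sinh s / s) (Set.Ioi 0) := by
    refine monotoneOn_of_deriv_nonneg (convex_Ioi _)
      (fun s hs => (hd s hs).continuousAt.continuousWithinAt) ?_ ?_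
    · rw [interior_Ioi]
      exact fun s hs => (hd s hs).differentiableAt.differentiableWithinAt
    · rw [interior_Ioi]
      intro s hs
      rw [(hd s hs).deriv]
      have := hm (Set.mem_Ici.2 le_rfl) (Set.mem_Ici.2 (le_of_lt hs)) (le_of_lt hs)
      simp at this
      exact div_nonneg (by linarith) (sq_nonneg s)
  exact h hx (hx.trans_le hxy) hxy

variable {k : ℝ}

lemma log_one_add_sq_div_pos (hk : 0 < k) {t : ℝ} (ht : 0 < t) :
    0 < Real.log (1 + t ^ 2 / k) := by
  refine Real.log_pos ?_
  have : 0 < t ^ 2 / k := by positivity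
  linarith

lemma wallace_pos (hk : 1 ≤ k) {t : ℝ} (ht : 0 < t) : 0 < wallace k t :=
  Real.sqrt_pos.2 (mul_pos (by linarith) (log_one_add_sq_div_pos (by linarith) ht))

lemma wallace_sq (hk : 1 ≤ k) {t : ℝ} (ht : 0 < t) :
    wallace k t ^ 2 = (k - 1 / 2) * Real.log (1 + t ^ 2 / k) :=
  Real.sq_sqrt (mul_pos (by linarith) (log_one_add_sq_div_pos (by linarith) ht)).le

lemma continuous_wallace (hk : 0 < k) : Continuous (wallace k) := by
  unfold wallace
  refine Real.continuous_sqrt.comp (continuous_const.mul (Continuous.log (by fun_prop) fun x => ?_))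
  positivity

lemma wallace_lt_wallace (hk : 1 ≤ k) {s t : ℝ} (hs : 0 ≤ s) (hst : s < t) :
    wallace k s < wallace k t := by
  unfold wallace
  have hk0 : 0 < k := by linarith
  have h : s ^ 2 / k < t ^ 2 / k := by gcongr
  refine Real.sqrt_lt_sqrt (mul_nonneg (by linarith) (Real.log_nonneg ?_)) ?_
  · have : 0 ≤ s ^ 2 / k := by positivity
    linarith
  · refine mul_lt_mul_of_pos_left (Real.log_lt_log (by positivity) ?_) (by linarith)
    linarith

/-- The derivative of `wallace k` at a positive point. -/
def wallaceDeriv (k t : ℝ) : ℝ :=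
  (k - 1 / 2) * (t / k) / ((1 + t ^ 2 / k) * wallace k t)

lemma hasDerivAt_wallace (hk : 1 ≤ k) {t : ℝ} (ht : 0 < t) :
    HasDerivAt (wallace k) (wallaceDeriv k t) t := by
  have hk0 : 0 < k := by linarith
  have hp : 0 < 1 + t ^ 2 / k := by positivity
  have h1 : HasDerivAt (fun t : ℝ => 1 + t ^ 2 / k) (2 * t / k) t := by
    simpa using ((hasDerivAt_pow 2 t).div_const k).const_add 1
  have h2 : HasDerivAt (wallace k) _ t := ((h1.log hp.ne').const_mul (k - 1 / 2)).sqrt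
    (mul_pos (by linarith) (log_one_add_sq_div_pos hk0 ht)).ne'
  refine h2.congr_deriv ?_
  have hw := wallace_pos hk ht
  change (k - 1 / 2) * (2 * t / k / (1 + t ^ 2 / k)) / (2 * wallace k t) = _
  unfold wallaceDeriv
  field_simp

/-- The shift `1/2` in `wallace` makes the exponentials combine: the squared ratio of the
transported normal density to Student's density is a constant times `sinh(L/2)/(L/2)`, with `L =
log(1 + t²/k)`, hence nondecreasing in `t`. -/
lemma sq_normalPDF_mul_wallaceDeriv (hk : 1 ≤ k) {t : ℝ} (ht : 0 < t) :
    (normalPDF (wallace k t) * wallaceDeriv k t) ^ 2 =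
      (k - 1 / 2) / (2 * Real.pi * k * studentConst k ^ 2) * studentPDF k t ^ 2 *
        (Real.sinh (Real.log (1 + t ^ 2 / k) / 2) / (Real.log (1 + t ^ 2 / k) / 2)) := by
  have hk0 : 0 < k := by linarith
  have hp : 0 < 1 + t ^ 2 / k := by positivity
  have hL := log_one_add_sq_div_pos hk0 ht
  have hw := wallace_sq hk ht
  have hpi := Real.pi_pos
  have hC := studentConst_pos hk0
  have hk2 : 0 < k - 1 / 2 := by linarith
  set L := Real.log (1 + t ^ 2 / k) with hLdef
  have hE : 1 + t ^ 2 / k = Real.exp L := (Real.exp_log hp).symm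
  have ht2 : t ^ 2 = k * (Real.exp L - 1) := by
    rw [← hE]; field_simp; ring
  have hf : studentPDF k t ^ 2 = studentConst k ^ 2 * Real.exp (-(k + 1) * L) := by
    unfold studentPDF
    rw [mul_pow, hE, ← Real.exp_mul, ← Real.exp_nat_mul]
    congr 2
    push_cast
    ring
  have hφ : normalPDF (wallace k t) ^ 2 = (2 * Real.pi)⁻¹ * Real.exp (-(k - 1 / 2) * L) := by
    unfold normalPDF
    rw [hw, mul_pow, inv_pow, Real.sq_sqrt (by positivity), ← Real.exp_nat_mul]
    congr 2
    push_cast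
    ring
  have hd : wallaceDeriv k t ^ 2 =
      (k - 1 / 2) * (Real.exp L - 1) / (k * L) * Real.exp (-2 * L) := by
    unfold wallaceDeriv
    rw [div_pow, mul_pow, mul_pow, div_pow, hw, hE, ht2, show -2 * L = -(2 * L) by ring,
      Real.exp_neg, show Real.exp (2 * L) = Real.exp L ^ 2 by
        rw [← Real.exp_nat_mul]; norm_num]
    field_simp
  have hs : Real.sinh (L / 2) / (L / 2) = Real.exp (-L / 2) * (Real.exp L - 1) / L := by
    have : Real.exp (-L / 2) * Real.exp L = Real.exp (L / 2) := by
      rw [← Real.exp_add]; congr 1; ring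
    rw [Real.sinh_eq, mul_sub, this, show -(L / 2) = -L / 2 by ring]
    field_simp
  rw [mul_pow, hφ, hd, hf, hs]
  have e1 : Real.exp (-(k - 1 / 2) * L) * Real.exp (-2 * L) =
      Real.exp (-(k + 1) * L) * Real.exp (-L / 2) := by
    rw [← Real.exp_add, ← Real.exp_add]; congr 1; ring
  calc (2 * Real.pi)⁻¹ * Real.exp (-(k - 1 / 2) * L) *
        ((k - 1 / 2) * (Real.exp L - 1) / (k * L) * Real.exp (-2 * L))
      = (2 * Real.pi)⁻¹ * ((k - 1 / 2) * (Real.exp L - 1) / (k * L)) *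
        (Real.exp (-(k - 1 / 2) * L) * Real.exp (-2 * L)) := by ring
    _ = _ := by
        rw [e1]
        field_simp

/-- Since the density ratio is monotone, the two densities cross at most once. -/
lemma studentPDF_le_of_lt (hk : 1 ≤ k) {c t : ℝ} (hc : 0 < c) (hct : c ≤ t)
    (h : studentPDF k c < normalPDF (wallace k c) * wallaceDeriv k c) :
    studentPDF k t ≤ normalPDF (wallace k t) * wallaceDeriv k t := by
  have hk0 : 0 < k := by linarith
  have ht := hc.trans_le hct
  have hfc := studentPDF_pos hk0 c
  have hft := studentPDF_pos hk0 t
  have hK : 0 < (k - 1 / 2) / (2 * Real.pi * k * studentConst k ^ 2) := by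
    have := Real.pi_pos
    have := studentConst_pos hk0
    exact div_pos (by linarith) (by positivity)
  have hwd : 0 ≤ wallaceDeriv k t := by
    have := wallace_pos hk ht
    have : 0 < k - 1 / 2 := by linarith
    unfold wallaceDeriv
    positivity
  have h1 := sq_normalPDF_mul_wallaceDeriv hk hc
  have h2 := sq_normalPDF_mul_wallaceDeriv hk ht
  have hmono := sinh_div_le_sinh_div
    (x := Real.log (1 + c ^ 2 / k) / 2) (y := Real.log (1 + t ^ 2 / k) / 2)
    (half_pos (log_one_add_sq_div_pos hk0 hc))
    (by gcongr)
  have h3 : studentPDF k c ^ 2 < (normalPDF (wallace k c) * wallaceDeriv k c) ^ 2 := by gcongr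
  rw [h1, mul_right_comm] at h3
  have h4 := (lt_mul_iff_one_lt_left (pow_pos hfc 2)).1 h3
  have h5 := h4.le.trans (mul_le_mul_of_nonneg_left hmono hK.le)
  refine le_of_sq_le_sq ?_ (mul_nonneg (normalPDF_pos _).le hwd)
  rw [h2, mul_right_comm]
  exact le_mul_of_one_le_left (sq_nonneg _) h5

/-- Wallace's bound: Student's law puts at least as much mass on `[0, t]` as the standard normal
law does on `[0, wallace k t]`. -/
lemma integral_normalPDF_le_integral_studentPDF (hk : 1 ≤ k) {t : ℝ} (ht : 0 ≤ t) :
    ∫ s in (0 : ℝ)..wallace k t, normalPDF s ≤ ∫ s in (0 : ℝ)..t, studentPDF k s := by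
  have hk0 : 0 < k := by linarith
  set D : ℝ → ℝ := fun t => (∫ s in (0 : ℝ)..t, studentPDF k s) -
    ∫ s in (0 : ℝ)..wallace k t, normalPDF s with hD
  have hF : ∀ x, HasDerivAt (fun x => ∫ s in (0 : ℝ)..x, studentPDF k s) (studentPDF k x) x :=
    fun x => (continuous_studentPDF hk0).integral_hasStrictDerivAt 0 x |>.hasDerivAt
  have hΦ : ∀ x, HasDerivAt (fun x => ∫ s in (0 : ℝ)..x, normalPDF s) (normalPDF x) x :=
    fun x => continuous_normalPDF.integral_hasStrictDerivAt 0 x |>.hasDerivAt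
  have hDd : ∀ x, 0 < x → HasDerivAt D
      (studentPDF k x - normalPDF (wallace k x) * wallaceDeriv k x) x := fun x hx =>
    (hF x).sub ((hΦ (wallace k x)).comp x (hasDerivAt_wallace hk hx))
  have hDc : Continuous D :=
    (continuous_iff_continuousAt.2 fun x => (hF x).continuousAt).sub
      ((continuous_iff_continuousAt.2 fun x => (hΦ x).continuousAt).comp (continuous_wallace hk0))
  have hwt : Filter.Tendsto (wallace k) Filter.atTop Filter.atTop := by
    refine Real.tendsto_sqrt_atTop.comp (Filter.Tendsto.const_mul_atTop (by linarith)
      (Real.tendsto_log_atTop.comp (Filter.tendsto_atTop_add_const_left _ _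
        (Filter.Tendsto.atTop_div_const hk0 (Filter.tendsto_pow_atTop two_ne_zero)))))
  have hlim : Filter.Tendsto D Filter.atTop (nhds 0) := by
    have h := (tendsto_integral_of_even (integrable_studentPDF hk0) (studentPDF_neg k)
      (integral_studentPDF hk0)).sub ((tendsto_integral_of_even integrable_normalPDF
        normalPDF_neg integral_normalPDF).comp hwt)
    rwa [sub_self] at h
  have hD0 : D 0 = 0 := by simp [hD, wallace]
  -- `D` vanishes at `0` and at infinity. If `D t < 0`, the mean value theorem yields `c < t` with
  -- `D' c < 0`; by single crossing `D` is nonincreasing beyond `c`, so `D t` is at least its limit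
  -- `0`.
  by_contra hcon
  have hneg : D t < 0 := by simp only [hD]; linarith
  have ht0 : 0 < t := lt_of_le_of_ne ht (by rintro rfl; linarith)
  obtain ⟨c, hc, hc'⟩ := exists_hasDerivAt_eq_slope D _ ht0 hDc.continuousOn
    (fun x hx => hDd x hx.1)
  have hcneg : studentPDF k c < normalPDF (wallace k c) * wallaceDeriv k c := by
    have : (D t - D 0) / (t - 0) < 0 := div_neg_of_neg_of_pos (by linarith) (by linarith)
    linarith
  have hanti : AntitoneOn D (Set.Ici c) := by
    refine antitoneOn_of_deriv_nonpos (convex_Ici c) hDc.continuousOn ?_ ?_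
    · rw [interior_Ici]
      exact fun x hx => (hDd x (hc.1.trans hx)).differentiableAt.differentiableWithinAt
    · rw [interior_Ici]
      intro x hx
      rw [(hDd x (hc.1.trans hx)).deriv]
      linarith [studentPDF_le_of_lt hk hc.1 (le_of_lt hx) hcneg]
  have hle : 0 ≤ D t := by
    refine le_of_tendsto hlim ?_
    filter_upwards [Filter.eventually_ge_atTop t] with x hx
    exact hanti hc.2.le (hc.2.le.trans hx) hx
  linarith

lemma studentT_real_Iic_neg_le (hk : 1 ≤ k) {t : ℝ} (ht : 0 ≤ t) :
    (studentT k).real (Set.Iic (-t)) ≤ (gaussianReal 0 1).real (Set.Iic (-wallace k t)) := by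
  rw [studentT_real_Iic_neg (by linarith), gaussianReal_real_Iic_neg]
  linarith [integral_normalPDF_le_integral_studentPDF hk ht]

end Wallace

/-! ### A normal tail estimate through Mills' ratio. -/

section Mills

/-- The rational function `(x² + 2) / (x³ + 3x)`, an upper bound for Mills' ratio. -/
def millsBound (x : ℝ) : ℝ := (x ^ 2 + 2) / (x ^ 3 + 3 * x)

lemma hasDerivAt_millsBound {x : ℝ} (hx : 0 < x) :
    HasDerivAt millsBound (-(x ^ 4 + 3 * x ^ 2 + 6) / (x ^ 3 + 3 * x) ^ 2) x := by
  have h0 : 0 < x ^ 3 + 3 * x := by positivity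
  have h1 : HasDerivAt (fun x : ℝ => x ^ 2 + 2) (2 * x) x := by
    simpa using (hasDerivAt_pow 2 x).add_const 2
  have h2 : HasDerivAt (fun x : ℝ => x ^ 3 + 3 * x) (3 * x ^ 2 + 3) x := by
    refine ((hasDerivAt_pow 3 x).add ((hasDerivAt_id x).const_mul 3)).congr_deriv ?_
    norm_num
  refine (h1.div h2 h0.ne').congr_deriv ?_
  congr 1
  ring

lemma hasDerivAt_normalPDF (x : ℝ) : HasDerivAt normalPDF (-(x * normalPDF x)) x := by
  have h1 : HasDerivAt (fun x : ℝ => -x ^ 2 / 2) (-x) x := by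
    refine (((hasDerivAt_pow 2 x).neg).div_const 2).congr_deriv ?_
    norm_num
    ring
  refine (h1.exp.const_mul (√(2 * Real.pi))⁻¹).congr_deriv ?_
  unfold normalPDF
  ring

lemma normalPDF_le_one (x : ℝ) : normalPDF x ≤ 1 := by
  have h1 : (√(2 * Real.pi))⁻¹ ≤ 1 :=
    inv_le_one_of_one_le₀ (Real.one_le_sqrt.2 (by linarith [Real.pi_gt_three]))
  have h2 : Real.exp (-x ^ 2 / 2) ≤ 1 := Real.exp_le_one_iff.2 (by nlinarith [sq_nonneg x])
  exact mul_le_one₀ h1 (Real.exp_pos _).le h2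

/-- The difference `E` of the two sides has derivative `6 * normalPDF x / (x³ + 3x)²`, so it
increases to its limit `0` and is nonpositive. -/
lemma half_sub_integral_normalPDF_le {z : ℝ} (hz : 0 < z) :
    1 / 2 - ∫ s in (0 : ℝ)..z, normalPDF s ≤ normalPDF z * millsBound z := by
  set E : ℝ → ℝ := fun x => 1 / 2 - (∫ s in (0 : ℝ)..x, normalPDF s) -
    normalPDF x * millsBound x with hE
  have hd : ∀ x, 0 < x → HasDerivAt E (-normalPDF x - (-(x * normalPDF x) * millsBound x +
      normalPDF x * (-(x ^ 4 + 3 * x ^ 2 + 6) / (x ^ 3 + 3 * x) ^ 2))) x := fun x hx =>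
    ((continuous_normalPDF.integral_hasStrictDerivAt 0 x).hasDerivAt.const_sub _).sub
      ((hasDerivAt_normalPDF x).mul (hasDerivAt_millsBound hx))
  have hnn : ∀ x, 0 < x → 0 ≤ -normalPDF x - (-(x * normalPDF x) * millsBound x +
      normalPDF x * (-(x ^ 4 + 3 * x ^ 2 + 6) / (x ^ 3 + 3 * x) ^ 2)) := by
    intro x hx
    have e : -normalPDF x - (-(x * normalPDF x) * millsBound x +
        normalPDF x * (-(x ^ 4 + 3 * x ^ 2 + 6) / (x ^ 3 + 3 * x) ^ 2)) =
        normalPDF x * (6 / (x ^ 3 + 3 * x) ^ 2) := by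
      have h0 : x ^ 3 + 3 * x ≠ 0 := by positivity
      unfold millsBound
      field_simp
      ring
    rw [e]
    exact mul_nonneg (normalPDF_pos x).le (by positivity)
  have hmono : MonotoneOn E (Set.Ioi 0) := by
    refine monotoneOn_of_deriv_nonneg (convex_Ioi 0)
      (fun x hx => (hd x hx).continuousAt.continuousWithinAt) ?_ ?_
    · rw [interior_Ioi]
      exact fun x hx => (hd x hx).differentiableAt.differentiableWithinAt
    · rw [interior_Ioi]
      intro x hx
      rw [(hd x hx).deriv]
      exact hnn x hx
  have hprod : Filter.Tendsto (fun x => normalPDF x * millsBound x) Filter.atTop (nhds 0) := by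
    refine squeeze_zero' ?_ ?_ tendsto_inv_atTop_zero
    · filter_upwards [Filter.eventually_gt_atTop 0] with x hx
      exact mul_nonneg (normalPDF_pos x).le (by unfold millsBound; positivity)
    · filter_upwards [Filter.eventually_gt_atTop 0] with x hx
      have h1 : millsBound x ≤ x⁻¹ := by
        unfold millsBound
        rw [inv_eq_one_div, div_le_div_iff₀ (by positivity) hx]
        nlinarith
      have h2 : 0 ≤ millsBound x := by unfold millsBound; positivity
      exact (mul_le_of_le_one_left h2 (normalPDF_le_one x)).trans h1
  have hlim : Filter.Tendsto E Filter.atTop (nhds 0) := by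
    have h := ((tendsto_integral_of_even integrable_normalPDF normalPDF_neg
      integral_normalPDF).const_sub (1 / 2)).sub hprod
    simpa only [sub_self, sub_zero] using h
  have : E z ≤ 0 := by
    refine ge_of_tendsto hlim ?_
    filter_upwards [Filter.eventually_ge_atTop z] with x hx
    exact hmono hz (hz.trans_le hx) hx
  simp only [hE] at this
  linarith

/-- `133/20` is slightly more than the square of the `1/200`-quantile (about `6.635`); the estimate
below gives a tail of about `0.00499`. -/
lemma gaussianReal_real_Iic_lt : (gaussianReal 0 1).real (Set.Iic (-√(133 / 20))) < 1 / 200 := by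
  rw [gaussianReal_real_Iic_neg]
  have hz : 0 < √(133 / 20 : ℝ) := Real.sqrt_pos.2 (by norm_num)
  refine (half_sub_integral_normalPDF_le hz).trans_lt ?_
  have hsq : √(133 / 20 : ℝ) ^ 2 = 133 / 20 := Real.sq_sqrt (by norm_num)
  have hm : millsBound √(133 / 20) = 173 / 193 / √(133 / 20) := by
    have e : √(133 / 20 : ℝ) ^ 3 + 3 * √(133 / 20) = 193 / 20 * √(133 / 20) := by
      rw [pow_succ, hsq]; ring
    rw [millsBound, e, hsq]
    field_simp
    norm_num
  have hpi := Real.pi_gt_d4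
  have hprod : (6463 / 1000 : ℝ) ≤ √(2 * Real.pi) * √(133 / 20) := by
    rw [← Real.sqrt_mul (by positivity)]
    refine Real.le_sqrt_of_sq_le ?_
    norm_num at hpi ⊢
    linarith
  have hexp : (2779 / 100 : ℝ) ≤ Real.exp (133 / 40) := by
    have h := Real.sum_le_exp_of_nonneg (x := 133 / 160) (by norm_num) 9
    have e : Real.exp (133 / 40) = Real.exp (133 / 160) ^ 4 := by
      rw [← Real.exp_nat_mul]; norm_num
    rw [e]
    refine le_trans ?_ (pow_le_pow_left₀ (Finset.sum_nonneg fun i _ => by positivity) h 4)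
    norm_num [Finset.sum_range_succ, Nat.factorial]
  have hs : 0 < √(2 * Real.pi) := Real.sqrt_pos.2 (by linarith)
  have e : normalPDF √(133 / 20) * millsBound √(133 / 20) =
      173 / 193 / ((√(2 * Real.pi) * √(133 / 20)) * Real.exp (133 / 40)) := by
    rw [hm, normalPDF, hsq, show (-(133 / 20) / 2 : ℝ) = -(133 / 40) by norm_num, Real.exp_neg]
    field_simp
  rw [e, div_lt_iff₀ (by positivity)]
  have h2 : (6463 / 1000 : ℝ) * (2779 / 100) ≤
      (√(2 * Real.pi) * √(133 / 20)) * Real.exp (133 / 40) :=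
    mul_le_mul hprod hexp (by norm_num) (by positivity)
  refine lt_of_lt_of_le ?_ (mul_le_mul_of_nonneg_left h2 (by norm_num))
  norm_num

end Mills

/-! ### Quantiles as infima. -/

section Quantile

variable {μ : Measure ℝ} [IsFiniteMeasure μ] {p x y : ℝ}

lemma lt_of_real_Iic_lt (hy : μ.real (Set.Iic y) < p) (hx : p ≤ μ.real (Set.Iic x)) : y < x := by
  by_contra h
  have := measureReal_mono (μ := μ) (Set.Iic_subset_Iic.2 (not_lt.1 h))
  linarith

/-- The point `y` bounds the defining set from below, which excludes the default value `0` of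
`sInf`. -/
lemma quantile_le (hy : μ.real (Set.Iic y) < p) (hx : p ≤ μ.real (Set.Iic x)) :
    quantile μ p ≤ x :=
  csInf_le ⟨y, fun _ h => (lt_of_real_Iic_lt hy h).le⟩ hx

lemma le_quantile (hy : μ.real (Set.Iic y) < p) (hx : p ≤ μ.real (Set.Iic x)) :
    y ≤ quantile μ p :=
  le_csInf ⟨x, hx⟩ fun _ h => (lt_of_real_Iic_lt hy h).le

lemma real_Iic_lt_of_lt_quantile (hy : μ.real (Set.Iic y) < p) (hx : x < quantile μ p) :
    μ.real (Set.Iic x) < p := by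
  by_contra h
  exact absurd (quantile_le hy (not_lt.1 h)) (not_le.2 hx)

end Quantile

/-! ### Bounds for the three quantiles and their comparison. -/

section QuantileBounds

variable {p : ℝ}

lemma gaussianReal_real_Iic_zero : (gaussianReal 0 1).real (Set.Iic 0) = 1 / 2 := by
  simp [gaussianReal_real_Iic_eq]

lemma zQuantile_nonpos (hp : 1 / 200 ≤ p) (hp' : p ≤ 1 / 2) : zQuantile p ≤ 0 :=
  quantile_le (gaussianReal_real_Iic_lt.trans_le hp) (by rwa [gaussianReal_real_Iic_zero])

lemma neg_sqrt_le_zQuantile (hp : 1 / 200 ≤ p) (hp' : p ≤ 1 / 2) :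
    -√(133 / 20) ≤ zQuantile p :=
  le_quantile (x := 0) (gaussianReal_real_Iic_lt.trans_le hp) (by rwa [gaussianReal_real_Iic_zero])

lemma zQuantile_sq_le (hp : 1 / 200 ≤ p) (hp' : p ≤ 1 / 2) : zQuantile p ^ 2 ≤ 133 / 20 := by
  have h1 := zQuantile_nonpos hp hp'
  have h2 := neg_sqrt_le_zQuantile hp hp'
  have h3 : √(133 / 20 : ℝ) ^ 2 = 133 / 20 := Real.sq_sqrt (by norm_num)
  rw [← h3]
  exact sq_le_sq' h2 (h1.trans (Real.sqrt_nonneg _))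

/-- Howe's factor uses the upper quantile, the main comparison the lower one; this half of the
symmetry suffices. Positivity of the density makes the distribution function strictly increasing,
which rules out a smaller candidate `y`. -/
lemma neg_zQuantile_le_zQuantile_one_sub (hp : 0 < p) (hp' : p ≤ 1 / 2) :
    -zQuantile p ≤ zQuantile (1 - p) := by
  have hne : ∃ y, 1 - p ≤ (gaussianReal 0 1).real (Set.Iic y) := by
    obtain ⟨y, hy⟩ := ((tendsto_integral_of_even integrable_normalPDF normalPDF_neg
      integral_normalPDF).eventually (lt_mem_nhds (show 1 / 2 - p < 1 / 2 by linarith))).exists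
    refine ⟨y, ?_⟩
    rw [gaussianReal_real_Iic_eq]
    linarith
  refine le_csInf hne fun y hy => ?_
  have hy : 1 - p ≤ (gaussianReal 0 1).real (Set.Iic y) := hy
  by_contra hlt
  have hneg : (gaussianReal 0 1).real (Set.Iic (-y)) ≤ p := by
    rw [gaussianReal_real_Iic_eq] at hy
    rw [gaussianReal_real_Iic_neg]
    linarith
  have hlt' : zQuantile p < -y := by linarith
  have hset : ({x : ℝ | p ≤ (gaussianReal 0 1).real (Set.Iic x)}).Nonempty :=
    ⟨0, by rwa [Set.mem_ofPred_eq, gaussianReal_real_Iic_zero]⟩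
  obtain ⟨m, hm, hm'⟩ := exists_lt_of_csInf_lt hset hlt'
  have hm : p ≤ (gaussianReal 0 1).real (Set.Iic m) := hm
  have hpos : 0 < ∫ s in m..(-y), normalPDF s :=
    intervalIntegral.intervalIntegral_pos_of_pos (continuous_normalPDF.intervalIntegrable _ _)
      normalPDF_pos hm'
  have hadd := intervalIntegral.integral_add_adjacent_intervals
    (continuous_normalPDF.intervalIntegrable (μ := volume) 0 m)
    (continuous_normalPDF.intervalIntegrable (μ := volume) m (-y))
  rw [gaussianReal_real_Iic_eq] at hm hneg
  linarith

variable {k : ℝ}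

lemma isProbabilityMeasure_studentT (hk : 0 < k) : IsProbabilityMeasure (studentT k) :=
  ⟨by rw [studentT, withDensity_apply _ MeasurableSet.univ, setLIntegral_univ,
    lintegral_studentPDF hk]⟩

lemma exists_studentT_real_Iic_lt (hk : 0 < k) (hp : 0 < p) :
    ∃ y, (studentT k).real (Set.Iic y) < p := by
  obtain ⟨y, hy⟩ := ((tendsto_integral_of_even (integrable_studentPDF hk) (studentPDF_neg k)
    (integral_studentPDF hk)).eventually (lt_mem_nhds
      (show 1 / 2 - p < 1 / 2 by linarith))).exists
  refine ⟨-y, ?_⟩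
  rw [studentT_real_Iic_neg hk]
  linarith

lemma tQuantile_neg (hk : 0 < k) (hp : 0 < p) (hp' : p < 1 / 2) : tQuantile p k < 0 := by
  have := isProbabilityMeasure_studentT hk
  obtain ⟨y, hy⟩ := exists_studentT_real_Iic_lt hk hp
  have hc : Filter.Tendsto (fun x => ∫ s in (0 : ℝ)..x, studentPDF k s) (nhds 0) (nhds 0) := by
    have := ((continuous_studentPDF hk).integral_hasStrictDerivAt 0 0).hasDerivAt.continuousAt
    simpa [ContinuousAt] using this
  obtain ⟨ε, hε, h⟩ := Metric.eventually_nhds_iff.1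
    (hc.eventually (gt_mem_nhds (show 0 < 1 / 2 - p by linarith)))
  have h2 := h (y := ε / 2) (by rw [Real.dist_eq, sub_zero, abs_of_pos] <;> linarith)
  have h3 : tQuantile p k ≤ -(ε / 2) := by
    refine quantile_le hy ?_
    rw [studentT_real_Iic_neg hk]
    linarith
  linarith

lemma isProbabilityMeasure_chiSquare (hk : 0 < k) : IsProbabilityMeasure (chiSquare k) :=
  isProbabilityMeasure_gammaMeasure (by linarith) (by norm_num)

lemma exists_pos_chiSquare_real_Iic_lt (hk : 2 ≤ k) (hp : 0 < p) :
    ∃ δ > 0, (chiSquare k).real (Set.Iic δ) < p := by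
  have hc : Filter.Tendsto (fun x => lowerGamma (k / 2) (x / 2) / Real.Gamma (k / 2))
      (nhds 0) (nhds 0) := by
    have h1 := ((continuous_rpow_mul_exp_neg (b := k / 2 - 1)
      (by linarith)).integral_hasStrictDerivAt 0 (0 / 2)).hasDerivAt.continuousAt
    have h2 : ContinuousAt (fun x : ℝ => x / 2) 0 := by fun_prop
    have h3 := (ContinuousAt.comp (f := fun x : ℝ => x / 2) h1 h2).div_const
      (Real.Gamma (k / 2))
    simpa [ContinuousAt, lowerGamma, Function.comp_def] using h3
  obtain ⟨ε, hε, h⟩ := Metric.eventually_nhds_iff.1 (hc.eventually (gt_mem_nhds hp))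
  refine ⟨ε / 2, half_pos hε, ?_⟩
  rw [chiSquare_real_Iic hk (by linarith)]
  exact h (by rw [Real.dist_eq, sub_zero, abs_of_pos] <;> linarith)

lemma chiSqQuantile_mem {k : ℕ} (hk : 19 ≤ k) (hp : 0 < p) (hp' : p ≤ 3 / 10) :
    0 < chiSqQuantile p k ∧ chiSqQuantile p k ≤ chiSqBound k := by
  have hk' : (19 : ℝ) ≤ k := by exact_mod_cast hk
  have := isProbabilityMeasure_chiSquare (k := (k : ℝ)) (by linarith)
  obtain ⟨δ, hδ, h⟩ := exists_pos_chiSquare_real_Iic_lt (k := (k : ℝ)) (by linarith) hp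
  have h2 := hp'.trans (chiSquare_real_Iic_chiSqBound hk)
  exact ⟨hδ.trans_le (le_quantile h h2), quantile_le h h2⟩

/-- The normal quantile, inflated by `√(k/c)` for an upper bound `c` of the admissible
chi-square quantiles, lies below the corresponding quantile of Student's law. -/
lemma zQuantile_mul_sqrt_le_tQuantile {k : ℕ} (hk : 19 ≤ k) {c : ℝ} (hc : 0 < c)
    (hc' : c ≤ chiSqBound k) (hp : 1 / 200 ≤ p) (hp' : p ≤ 1 / 2) :
    zQuantile p * √(k / c) ≤ tQuantile p k := by
  have hk' : (19 : ℝ) ≤ k := by exact_mod_cast hk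
  have hk0 : (0 : ℝ) < k := by linarith
  have hz := zQuantile_nonpos hp hp'
  -- The scaling by `√(k/c)` turns `t²/k` into `z²/c`, so this is the exponential inequality in
  -- logarithmic form.
  have hw : -zQuantile p ≤ wallace k (-zQuantile p * √(k / c)) := by
    refine Real.le_sqrt_of_sq_le ?_
    have e : (-zQuantile p * √(k / c)) ^ 2 / k = zQuantile p ^ 2 / c := by
      rw [mul_pow, Real.sq_sqrt (by positivity)]
      field_simp
    rw [e, neg_sq]
    exact le_mul_log_one_add_div hk (sq_nonneg _) (zQuantile_sq_le hp hp') hc hc'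
  refine le_csInf ⟨0, ?_⟩ fun x hx => ?_
  · have h := studentT_real_Iic_neg hk0 0
    rw [neg_zero, intervalIntegral.integral_same, sub_zero] at h
    change p ≤ _
    rw [h]
    exact hp'
  · have hx : p ≤ (studentT k).real (Set.Iic x) := hx
    -- A point `x` below the claimed bound has `-wallace k (-x) < zQuantile p`, so the normal mass
    -- there is below `p`; Wallace's bound puts the Student mass below `p` too.
    by_contra hlt
    have h0 : 0 ≤ -zQuantile p * √(k / c) := mul_nonneg (by linarith) (Real.sqrt_nonneg _)
    have hlt' : -zQuantile p * √(k / c) < -x := by linarith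
    have h1 := wallace_lt_wallace (k := (k : ℝ)) (by linarith) h0 hlt'
    have h2 := studentT_real_Iic_neg_le (k := (k : ℝ)) (by linarith) (h0.trans hlt'.le)
    rw [neg_neg] at h2
    have h3 := real_Iic_lt_of_lt_quantile (μ := gaussianReal 0 1) (x := -wallace k (-x))
      (gaussianReal_real_Iic_lt.trans_le hp)
      (show -wallace k (-x) < zQuantile p by linarith)
    linarith

end QuantileBounds

/-! ### Interval sizes and the theorem. -/

lemma size_predictionInterval {n : ℕ} (β : ℝ) (x : Fin n → ℝ) :
    size (predictionInterval β x) = 2 * (predictionFactor n β * sampleStd x) := by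
  simp only [size, predictionInterval]; ring

lemma size_toleranceInterval {n : ℕ} (γ β : ℝ) (x : Fin n → ℝ) :
    size (toleranceInterval γ β x) = 2 * (toleranceFactor n γ β * sampleStd x) := by
  simp only [size, toleranceInterval]; ring

end NormalIntervals

end

theorem proposition2 (n : ℕ) (hn : 20 ≤ n) (hn' : n ≤ 10000)
    (γ : ℝ) (hγ : 7 / 10 ≤ γ) (hγ' : γ < 1)
    (β : ℝ) (hβ : 1 / 100 ≤ β) (hβ' : β ≤ 99 / 100) :
    (∀ x : Fin n → ℝ,
      NormalIntervals.size (NormalIntervals.predictionInterval β x) ≤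
        NormalIntervals.size (NormalIntervals.toleranceInterval γ β x)) ∧
    1 ≤ NormalIntervals.zQuantile ((1 - β) / 2) * Real.sqrt ((n : ℝ) - 1) /
      (NormalIntervals.tQuantile ((1 - β) / 2) ((n : ℝ) - 1) *
        Real.sqrt (NormalIntervals.chiSqQuantile (1 - γ) ((n : ℝ) - 1))) := by
  open NormalIntervals in
  obtain ⟨k, rfl⟩ : ∃ k, n = k + 1 := ⟨n - 1, by omega⟩
  have hk : 19 ≤ k := by omega
  have hk' : (19 : ℝ) ≤ k := by exact_mod_cast hk
  have hcast : ((k + 1 : ℕ) : ℝ) - 1 = k := by push_cast; ring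
  obtain ⟨hc, hc'⟩ := chiSqQuantile_mem hk (p := 1 - γ) (by linarith) (by linarith)
  have hp : 1 / 200 ≤ (1 - β) / 2 := by linarith
  have hp' : (1 - β) / 2 < 1 / 2 := by linarith
  have hmain := zQuantile_mul_sqrt_le_tQuantile hk hc hc' hp hp'.le
  have ht := tQuantile_neg (k := (k : ℝ)) (p := (1 - β) / 2) (by linarith) (by linarith) hp'
  have hz := neg_zQuantile_le_zQuantile_one_sub (p := (1 - β) / 2) (by linarith) hp'.le
  refine ⟨fun x => ?_, ?_⟩
  · rw [size_predictionInterval, size_toleranceInterval]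
    refine mul_le_mul_of_nonneg_left (mul_le_mul_of_nonneg_right ?_ (Real.sqrt_nonneg _))
      (by norm_num)
    rw [predictionFactor, toleranceFactor, hcast, abs_of_neg ht]
    set c := chiSqQuantile (1 - γ) k
    set z' := zQuantile (1 - (1 - β) / 2)
    set s : ℝ := 1 + 1 / ((k + 1 : ℕ) : ℝ)
    have hs : 0 ≤ s := by positivity
    have e : (k : ℝ) * s * z' ^ 2 / c = z' ^ 2 * (k / c) * s := by ring
    rw [e, Real.sqrt_mul (by positivity), Real.sqrt_mul (sq_nonneg _), Real.sqrt_sq_eq_abs]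
    refine mul_le_mul_of_nonneg_right ?_ (Real.sqrt_nonneg _)
    have h1 : -zQuantile ((1 - β) / 2) * √(k / c) ≤ |z'| * √(k / c) :=
      mul_le_mul_of_nonneg_right (hz.trans (le_abs_self _)) (Real.sqrt_nonneg _)
    linarith
  · rw [hcast]
    have hsc := Real.sqrt_pos.2 hc
    -- The Student quantile is negative, so clearing the denominator reverses the inequality.
    rw [one_le_div_of_neg (mul_neg_of_neg_of_pos ht hsc)]
    rw [Real.sqrt_div (by positivity), mul_div_assoc', div_le_iff₀ hsc] at hmain
    exact hmain
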